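/- All groups are finite. Let $p$ be a prime. A $p$-group is called extraspecial if its derived subgroup and its center both have order $p$. A $p$-group $G$ is called semi-extraspecial if $G/N$ is extraspecial for every maximal subgroup $N$ of its center $Z(G)$; a semi-extraspecial $p$-group $G$ with $|G:Z(G)| = p^{2a}$ is called ultraspecial if $|Z(G)| = p^{a}$. Let $G$ be a semi-extraspecial $p$-group with $|G:Z(G)| = p^{2a}$ that has an automorphism $\sigma$ of order $p^{2a}-1$. Then the following hold: (1) $G$ is ultraspecial, that is, $|Z(G)| = p^a$. (2) The restriction of $\sigma$ to $Z(G)$ is an automorphism of $Z(G)$ of order $|Z(G)| - 1 = p^a - 1$. (3) The automorphism of $G/Z(G)$ induced by $\sigma^{p^a-1}$ has order $p^a+1$. -/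

import Mathlib

/-- A `p`-group `G` is extraspecial if its derived subgroup and its center both have order `p`. -/
def IsExtraspecial (p : ℕ) (G : Type*) [Group G] : Prop :=
  IsPGroup p G ∧ Nat.card (commutator G) = p ∧ Nat.card (Subgroup.center G) = p

/-- A `p`-group `G` is semi-extraspecial if `G ⧸ N` is extraspecial for every maximal subgroup `N`
of the center of `G`. The relation `N ⋖ Subgroup.center G` says that `N` is a proper subgroup of
the center with no subgroup strictly in between; such an `N` is automatically normal in `G`, and
the instance argument only serves to form the quotient group. -/
def IsSemiExtraspecial (p : ℕ) (G : Type*) [Group G] : Prop :=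
  IsPGroup p G ∧
    ∀ (N : Subgroup G) [N.Normal], N ⋖ Subgroup.center G → IsExtraspecial p (G ⧸ N)

/-- A semi-extraspecial `p`-group `G` with `|G : Z(G)| = p ^ (2 * a)` is ultraspecial if
`|Z(G)| = p ^ a`. -/
def IsUltraspecial (p : ℕ) (G : Type*) [Group G] : Prop :=
  IsSemiExtraspecial p G ∧
    ∃ a : ℕ, (Subgroup.center G).index = p ^ (2 * a) ∧ Nat.card (Subgroup.center G) = p ^ a

/-- The restriction of an automorphism of `G` to the center of `G`. -/
def MulAut.restrictCenter {G : Type*} [Group G] (σ : MulAut G) : MulAut (Subgroup.center G) :=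
  Subgroup.centerCongr σ

/-- The automorphism of `G ⧸ Z(G)` induced by an automorphism of `G`. -/
def MulAut.quotientCenter {G : Type*} [Group G] (σ : MulAut G) :
    MulAut (G ⧸ Subgroup.center G) :=
  QuotientGroup.congr (Subgroup.center G) (Subgroup.center G) σ
    (Subgroup.characteristic_iff_map_eq.mp inferInstance σ)

theorem MulAut.coe_restrictCenter_apply {G : Type*} [Group G] (σ : MulAut G)
    (z : Subgroup.center G) : (σ.restrictCenter z : G) = σ z :=
  rfl

theorem MulAut.quotientCenter_mk {G : Type*} [Group G] (σ : MulAut G) (g : G) :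
    σ.quotientCenter (g : G ⧸ Subgroup.center G) = ((σ g : G) : G ⧸ Subgroup.center G) :=
  rfl

/-! Commutation is an alternating pairing on `V = G/Z(G)`, of order `p^(2a)`, with values in `Z =
Z(G)`; semi-extraspeciality makes it onto `Z` in each nonzero argument. Since `p^(2a) - 1` is prime
to `p`, `σ` keeps its order on `V`. A linear map of this order generates a field `K` acting simply
transitively on nonzero vectors, so `V` becomes `K`, `σ` becomes multiplication by a generator `ζ`,
and the pairing satisfies `b(ζx, ζy) = t b(x, y)`, where `t` is `σ` on `Z`.

The order of `t` comes from `orderOf_root_eq_of_bilinear`. If `e` is the order of a root of an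
irreducible factor of the minimal polynomial of `t`, then `η = ζ^e` preserves a nonzero bilinear map
on `K`. Hence `η⁻¹` is conjugate to `η`, and `η⁻¹ = η^(p^k)`. Comparing orders forces `k = a` and `e
= p^a - 1`. Therefore `t^(p^a - 1) = 1`, and `ζ^(p^a - 1)` is an isometry of order `p^a + 1`
generating `K`. This makes `c ↦ c^(p^a)` the adjoint of multiplication by `c`, which gives `|Z| ≤
p^a` (`natCard_le_of_bilinear`); a root of order `p^a - 1` gives the reverse bound. -/

/-! ### Semi-invariant bilinear maps on a finite field: orders of roots. -/

section BilinearMaps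

open Polynomial

/-- If multiplication by `u` in the left argument of a bilinear map is multiplication by `v` in the
right argument, then the same holds for polynomials in `u` and `v`. -/
theorem LinearMap.apply_aeval_mul_eq {F K Z : Type*} [Field F] [Field K] [Algebra F K]
    [AddCommGroup Z] [Module F Z] (b : K →ₗ[F] K →ₗ[F] Z) {u v : K}
    (h : ∀ x y, b (u * x) y = b x (v * y)) (Q : F[X]) (x y : K) :
    b (aeval u Q * x) y = b x (aeval v Q * y) := by
  have hpow : ∀ (n : ℕ) (x y : K), b (u ^ n * x) y = b x (v ^ n * y) := by
    intro n
    induction n with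
    | zero => simp
    | succ n ih =>
      intro x y
      rw [pow_succ, pow_succ', mul_assoc, ih, h, mul_assoc]
  induction Q using Polynomial.induction_on' generalizing x y with
  | add f g hf hg => simp [add_mul, hf, hg]
  | monomial n c =>
    simp only [aeval_monomial, ← Algebra.smul_def, smul_mul_assoc, map_smul, LinearMap.smul_apply,
      hpow]

/-- If a nonzero bilinear form on a field transfers multiplication by `u` to multiplication by `v`,
then `u` and `v` are conjugate. -/
theorem LinearMap.aeval_minpoly_eq_zero_of_apply_mul_eq {F K Z : Type*} [Field F] [Field K]
    [Algebra F K] [AddCommGroup Z] [Module F Z] (b : K →ₗ[F] K →ₗ[F] Z) (hb : b ≠ 0) {u v : K}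
    (h : ∀ x y, b (u * x) y = b x (v * y)) : aeval v (minpoly F u) = 0 := by
  by_contra hne
  refine hb (LinearMap.ext fun x => LinearMap.ext fun y => ?_)
  have := b.apply_aeval_mul_eq h (minpoly F u) x ((aeval v (minpoly F u))⁻¹ * y)
  rw [minpoly.aeval, mul_inv_cancel_left₀ hne] at this
  simpa using this.symm

/-- Conjugate elements differ by a Galois automorphism, and the Galois group consists of the first
`n` powers of Frobenius. -/
theorem FiniteField.exists_pow_eq_of_aeval_minpoly_eq_zero {p n : ℕ} [Fact p.Prime] {K : Type*}
    [Field K] [Algebra (ZMod p) K] [Finite K] (hK : Nat.card K = p ^ n) {u v : K}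
    (h : aeval v (minpoly (ZMod p) u) = 0) : ∃ k < n, v = u ^ p ^ k := by
  have hfin : Module.finrank (ZMod p) K = n := by
    have h1 := Module.natCard_eq_pow_finrank (K := ZMod p) (V := K)
    rw [hK, Nat.card_zmod] at h1
    exact (Nat.pow_right_injective (Fact.out : p.Prime).two_le h1).symm
  have hconj : IsConjRoot (ZMod p) v u := by
    have hu : IsIntegral (ZMod p) u := Algebra.IsIntegral.isIntegral u
    exact (minpoly.eq_of_irreducible_of_monic (minpoly.irreducible hu) h
      (minpoly.monic hu)).symm
  obtain ⟨s, hs⟩ := isConjRoot_iff_exists_algEquiv.mp hconj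
  obtain ⟨k, hk⟩ := (FiniteField.bijective_frobeniusAlgEquivOfAlgebraic_pow (ZMod p) K).2 s
  refine ⟨k, hfin ▸ k.2, ?_⟩
  rw [← hs, ← hk, AlgEquiv.coe_pow, FiniteField.coe_frobeniusAlgEquivOfAlgebraic_iterate,
    ZMod.card]

theorem Nat.pow_two_mul_sub_one (p a : ℕ) : p ^ (2 * a) - 1 = (p ^ a - 1) * (p ^ a + 1) := by
  rw [mul_comm 2 a, pow_mul, mul_comm, ← Nat.sq_sub_sq, one_pow]

theorem AdjoinRoot.root_pow_eq_one_iff {F : Type*} [Field F] (P : F[X]) (j : ℕ) :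
    AdjoinRoot.root P ^ j = 1 ↔ P ∣ X ^ j - 1 := by
  rw [← AdjoinRoot.mk_eq_zero, map_sub, map_pow, AdjoinRoot.mk_X, map_one, sub_eq_zero]

theorem AdjoinRoot.natCard_zmod {p : ℕ} [Fact p.Prime] (P : (ZMod p)[X]) (hP : P ≠ 0) :
    Nat.card (AdjoinRoot P) = p ^ P.natDegree := by
  have : Module.Finite (ZMod p) (AdjoinRoot P) := (AdjoinRoot.powerBasis hP).finite
  rw [Module.natCard_eq_pow_finrank (K := ZMod p) (V := AdjoinRoot P), Nat.card_zmod,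
    (AdjoinRoot.powerBasis hP).finrank, AdjoinRoot.powerBasis_dim]

theorem orderOf_dvd_natCard_sub_one {E : Type*} [Field E] [Finite E] {w : E} (hw : w ≠ 0) :
    orderOf w ∣ Nat.card E - 1 := by
  have := Fintype.ofFinite E
  rw [Nat.card_eq_fintype_card]
  exact orderOf_dvd_of_pow_eq_one (FiniteField.pow_card_sub_one_eq_one w hw)

section

variable {p a : ℕ} [Fact p.Prime] {K Z : Type*} [Field K] [Algebra (ZMod p) K]
  [AddCommGroup Z] [Module (ZMod p) Z]

theorem LinearMap.apply_pow_mul_pow_mul {F : Type*} [Field F] [Algebra F K] [Module F Z]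
    {ζ : K} (b : K →ₗ[F] K →ₗ[F] Z) {t : Module.End F Z}
    (hbt : ∀ x y, b (ζ * x) (ζ * y) = t (b x y)) (n : ℕ) (x y : K) :
    b (ζ ^ n * x) (ζ ^ n * y) = (t ^ n) (b x y) := by
  induction n with
  | zero => simp
  | succ n ih => rw [pow_succ', pow_succ', mul_assoc, mul_assoc, hbt, ih, Module.End.mul_apply]

theorem LinearMap.apply_mul_eq_inv_mul {F : Type*} [Field F] [Algebra F K] [Module F Z]
    {η : K} (hη : η ≠ 0) (b : K →ₗ[F] K →ₗ[F] Z) (h : ∀ x y, b (η * x) (η * y) = b x y)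
    (x y : K) : b (η * x) y = b x (η⁻¹ * y) := by
  rw [← h x, mul_inv_cancel_left₀ hη]

/-- An irreducible factor of degree less than `2 * a` of the action of a Singer cycle on the values
of a bilinear map on the field with `p ^ (2 * a)` elements has roots of order `p ^ a - 1`. -/
theorem orderOf_root_eq_of_bilinear [Finite K] (hK : Nat.card K = p ^ (2 * a)) {ζ : K}
    (hζ : orderOf ζ = p ^ (2 * a) - 1) (b : K →ₗ[ZMod p] K →ₗ[ZMod p] Z) (hb : b ≠ 0)
    (t : Module.End (ZMod p) Z) (hbt : ∀ x y, b (ζ * x) (ζ * y) = t (b x y))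
    (P : (ZMod p)[X]) [hPirr : Fact (Irreducible P)] (hP : ∀ x y, aeval t P (b x y) = 0)
    (hdeg : P.natDegree < 2 * a) : orderOf (AdjoinRoot.root P) = p ^ a - 1 := by
  have hp : p.Prime := Fact.out
  have ha : 0 < a := by omega
  have hP0 : P ≠ 0 := hPirr.out.ne_zero
  have hq : 1 < p ^ (2 * a) := Nat.one_lt_pow (by omega) hp.one_lt
  have hpa : 1 < p ^ a := Nat.one_lt_pow (by omega) hp.one_lt
  have hζ0 : ζ ≠ 0 := by
    rintro rfl
    rw [orderOf_zero] at hζ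
    omega
  set w := AdjoinRoot.root P with hw
  have hcard := AdjoinRoot.natCard_zmod P hP0
  have hfinE : Finite (AdjoinRoot P) := Nat.finite_of_card_ne_zero (by
    rw [hcard]; exact pow_ne_zero _ hp.ne_zero)
  have hwq : w ^ (p ^ (2 * a) - 1) = 1 := by
    rw [hw, AdjoinRoot.root_pow_eq_one_iff]
    -- Otherwise `P` is coprime to `X^(p^(2a) - 1) - 1`; both kill the values of `b` when evaluated
    -- at `t`, so a Bézout relation gives `b = 0`.
    by_contra hnd
    obtain ⟨A, C, hAC⟩ := (hPirr.out.coprime_iff_not_dvd).mpr hnd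
    refine hb (LinearMap.ext fun x => LinearMap.ext fun y => ?_)
    have h1 : aeval t (X ^ (p ^ (2 * a) - 1) - 1 : (ZMod p)[X]) (b x y) = 0 := by
      have := b.apply_pow_mul_pow_mul hbt (p ^ (2 * a) - 1) x y
      rw [← hζ, pow_orderOf_eq_one, one_mul, one_mul, hζ] at this
      simp [← this]
    have h2 := congrArg (fun R => aeval t R (b x y)) hAC
    simpa only [map_add, map_mul, map_one, map_zero, LinearMap.add_apply, Module.End.mul_apply,
      Module.End.one_apply, LinearMap.zero_apply, hP x y, h1, add_zero] using h2.symm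
  have hw0 : w ≠ 0 := by
    rintro h0
    rw [h0, zero_pow (by omega)] at hwq
    exact zero_ne_one hwq
  set e := orderOf w with he
  have hepos : 0 < e := orderOf_pos_iff.mpr (isOfFinOrder_iff_pow_eq_one.mpr ⟨_, by omega, hwq⟩)
  have he1 : e ∣ p ^ (2 * a) - 1 := orderOf_dvd_of_pow_eq_one hwq
  have he2 : e ∣ p ^ P.natDegree - 1 := hcard ▸ orderOf_dvd_natCard_sub_one hw0
  have hdpos : 0 < P.natDegree := hPirr.out.natDegree_pos
  -- The gcd of `deg P < 2a` with `2a` is a proper divisor of `2a`, hence at most `a`.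
  have hele : e ≤ p ^ a - 1 := by
    have h3 := Nat.dvd_gcd he2 he1
    rw [Nat.pow_sub_one_gcd_pow_sub_one] at h3
    have hg : Nat.gcd P.natDegree (2 * a) ≤ a := by
      obtain ⟨c, hc⟩ := Nat.gcd_dvd_right P.natDegree (2 * a)
      have hle : Nat.gcd P.natDegree (2 * a) ≤ P.natDegree := Nat.gcd_le_left _ hdpos
      have hc2 : 2 ≤ c := by
        by_contra hc2
        have : c = 0 ∨ c = 1 := by omega
        rcases this with rfl | rfl <;> omega
      nlinarith
    have hgpos : 0 < Nat.gcd P.natDegree (2 * a) := Nat.gcd_pos_of_pos_left _ hdpos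
    have h4 : 1 < p ^ Nat.gcd P.natDegree (2 * a) := Nat.one_lt_pow hgpos.ne' hp.one_lt
    have h5 := Nat.le_of_dvd (by omega) h3
    have h6 := Nat.pow_le_pow_right hp.pos hg
    omega
  obtain ⟨N, hN⟩ := he1
  have hNe : N * e = (p ^ a - 1) * (p ^ a + 1) := by
    rw [← Nat.pow_two_mul_sub_one, hN, mul_comm]
  have hNge : p ^ a + 1 ≤ N := by
    by_contra hlt
    have h7 : (p ^ a - 1) * (p ^ a + 1) ≤ N * (p ^ a - 1) :=
      hNe ▸ Nat.mul_le_mul_left _ hele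
    have : N * (p ^ a - 1) < (p ^ a - 1) * (p ^ a + 1) := by
      rw [mul_comm]
      exact Nat.mul_lt_mul_of_pos_left (by omega) (by omega)
    omega
  set η := ζ ^ e with hη
  have hη0 : η ≠ 0 := pow_ne_zero _ hζ0
  have hηN : orderOf η = N := by
    rw [hη, orderOf_pow_of_dvd hepos.ne' (hζ ▸ ⟨N, hN⟩), hζ, hN, Nat.mul_div_cancel_left _ hepos]
  have hinv : ∀ x y, b (η * x) (η * y) = b x y := by
    intro x y
    rw [hη, b.apply_pow_mul_pow_mul hbt]
    have hdvd : P ∣ X ^ e - 1 := by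
      rw [← AdjoinRoot.root_pow_eq_one_iff, ← hw, he, pow_orderOf_eq_one]
    obtain ⟨R, hR⟩ := hdvd
    have h8 : aeval t (X ^ e - 1 : (ZMod p)[X]) (b x y) = 0 := by
      rw [hR, mul_comm, map_mul, Module.End.mul_apply, hP, map_zero]
    simpa [sub_eq_zero] using h8
  obtain ⟨k, hk, hηk⟩ := FiniteField.exists_pow_eq_of_aeval_minpoly_eq_zero hK
    (b.aeval_minpoly_eq_zero_of_apply_mul_eq hb (b.apply_mul_eq_inv_mul hη0 hinv))
  have hdvd1 : N ∣ p ^ k + 1 := by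
    rw [← hηN]
    refine orderOf_dvd_of_pow_eq_one ?_
    rw [pow_succ, ← hηk, inv_mul_cancel₀ hη0]
  -- Inversion on the powers of `η` is its own inverse, so it is also the Frobenius power with
  -- exponent `2a - k`.
  have hdvd2 : N ∣ p ^ (2 * a - k) + 1 := by
    rw [← hηN]
    refine orderOf_dvd_of_pow_eq_one ?_
    have h9 : η ^ p ^ (2 * a) = η := by
      have := Fintype.ofFinite K
      rw [← hK, Nat.card_eq_fintype_card, FiniteField.pow_card]
    have h10 : (η⁻¹) ^ p ^ (2 * a - k) = η := by
      rw [hηk, ← pow_mul, ← pow_add, Nat.add_sub_cancel' hk.le, h9]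
    rw [pow_succ]
    nth_rewrite 2 [← h10]
    rw [inv_pow, mul_inv_cancel₀ (pow_ne_zero _ hη0)]
  have hle : ∀ j, N ∣ p ^ j + 1 → a ≤ j := by
    intro j hj
    by_contra hlt
    have h11 := Nat.le_of_dvd (by omega) hj
    have h12 : p ^ j < p ^ a := Nat.pow_lt_pow_right hp.one_lt (by omega)
    omega
  -- Since `N ≥ p^a + 1`, both `k` and `2a - k` are at least `a`.
  have hka : k = a := by
    have := hle _ hdvd1
    have := hle _ hdvd2
    omega
  have hNeq : N = p ^ a + 1 :=
    le_antisymm (Nat.le_of_dvd (by omega) (hka ▸ hdvd1)) hNge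
  rw [hNeq, mul_comm] at hNe
  exact Nat.eq_of_mul_eq_mul_right (by omega) hNe

end

end BilinearMaps

/-! ### Alternating maps on a finite field: size of the value space. -/

section BilinearMaps

open Polynomial

/-- An irreducible factor of `f / gcd f g` would also divide the gcd, so its square would divide
`f`. -/
theorem Polynomial.dvd_of_squarefree_of_forall_irreducible_dvd {F : Type*} [Field F] {f g : F[X]}
    (hf : Squarefree f) (hf0 : f ≠ 0) (h : ∀ P, Irreducible P → P ∣ f → P ∣ g) : f ∣ g := by
  classical
  obtain ⟨c, hc⟩ := EuclideanDomain.gcd_dvd_left f g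
  have hc0 : c ≠ 0 := by
    rintro rfl
    exact hf0 (by rw [hc, mul_zero])
  by_cases hu : IsUnit c
  · have h1 : f ∣ EuclideanDomain.gcd f g := hc.dvd.trans (hu.mul_right_dvd.2 dvd_rfl)
    exact h1.trans (EuclideanDomain.gcd_dvd_right f g)
  · obtain ⟨P, hP, R, hR⟩ := WfDvdMonoid.exists_irreducible_factor hu hc0
    have hPf : P ∣ f := hc ▸ (Dvd.intro R hR.symm).mul_left _
    have hPg : P ∣ EuclideanDomain.gcd f g := EuclideanDomain.dvd_gcd hPf (h P hP hPf)
    refine absurd (hf P ?_) hP.not_isUnit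
    rw [hc]
    exact mul_dvd_mul hPg (Dvd.intro R hR.symm)

section

variable {p a : ℕ} [Fact p.Prime] {K Z : Type*} [Field K] [Algebra (ZMod p) K]
  [AddCommGroup Z] [Module (ZMod p) Z]

theorem finrank_zmod_eq_of_natCard_eq {V : Type*} [AddCommGroup V] [Module (ZMod p) V] [Finite V]
    {n : ℕ} (hV : Nat.card V = p ^ n) : Module.finrank (ZMod p) V = n := by
  have h1 := Module.natCard_eq_pow_finrank (K := ZMod p) (V := V)
  rw [hV, Nat.card_zmod] at h1
  exact (Nat.pow_right_injective (Fact.out : p.Prime).two_le h1).symm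

/-- An element of multiplicative order `p ^ a + 1` generates the field with `p ^ (2 * a)`
elements. -/
theorem exists_aeval_eq_of_orderOf_eq [Finite K] (hK : Nat.card K = p ^ (2 * a))
    {η : K} (hη : orderOf η = p ^ a + 1) (c : K) : ∃ Q : (ZMod p)[X], aeval η Q = c := by
  have hp : p.Prime := Fact.out
  have hη0 : η ≠ 0 := by
    rintro rfl
    rw [orderOf_zero] at hη
    have := pow_pos hp.pos a
    omega
  have hint : IsIntegral (ZMod p) η := Algebra.IsIntegral.isIntegral η
  have hdvd := Module.finrank_mul_finrank (ZMod p) (IntermediateField.adjoin (ZMod p) {η}) K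
  rw [finrank_zmod_eq_of_natCard_eq hK] at hdvd
  set E := IntermediateField.adjoin (ZMod p) {η} with hE
  set D := Module.finrank (ZMod p) E with hD
  have hDpos : 0 < D := Module.finrank_pos
  have hcard : Nat.card E = p ^ D := by
    rw [Module.natCard_eq_pow_finrank (K := ZMod p) (V := E), Nat.card_zmod]
  have h1 : p ^ a + 1 ∣ p ^ D - 1 := by
    have h2 : orderOf (⟨η, IntermediateField.mem_adjoin_simple_self (ZMod p) η⟩ : E) = p ^ a + 1 := by
      rw [← hη, ← orderOf_injective (algebraMap E K : E →* K) (algebraMap E K).injective]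
      rfl
    rw [← h2, ← hcard]
    exact orderOf_dvd_natCard_sub_one (fun h => hη0 (congrArg Subtype.val h))
  have haD : a < D := by
    by_contra hlt
    have h3 : p ^ D ≤ p ^ a := Nat.pow_le_pow_right hp.pos (by omega)
    have h4 : 1 < p ^ D := Nat.one_lt_pow hDpos.ne' hp.one_lt
    have := Nat.le_of_dvd (by omega) h1
    omega
  -- The degree `D` divides `2a` and exceeds `a`.
  have hone : Module.finrank E K = 1 := by
    have h5 : 0 < Module.finrank E K := Module.finrank_pos
    nlinarith
  have htop : E = ⊤ := by
    apply IntermediateField.finrank_eq_one_iff_eq_top.mp hone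
  have hc : c ∈ Algebra.adjoin (ZMod p) {η} := by
    rw [← IntermediateField.adjoin_simple_toSubalgebra_of_isAlgebraic hint.isAlgebraic, ← hE, htop]
    trivial
  rw [Algebra.adjoin_singleton_eq_range_aeval] at hc
  exact hc

theorem FiniteField.aeval_pow_pow_char (η : K) (Q : (ZMod p)[X]) :
    aeval (η ^ p ^ a) Q = aeval η Q ^ p ^ a := by
  induction a with
  | zero => simp
  | succ n ih =>
    have h := Polynomial.aeval_algHom_apply (FiniteField.frobeniusAlgHom (ZMod p) K) (η ^ p ^ n) Q
    simp only [FiniteField.frobeniusAlgHom_apply, ZMod.card] at h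
    rw [pow_succ, pow_mul, h, ih, pow_mul]

/-- Adjointness and alternation put every `c + c^(p^a)` in the kernel of `b 1`. The map `c ↦ c +
c^(p^a)` has at most `p^a` zeros, so its image, and hence that kernel, has dimension at least `a`.
-/
theorem natCard_le_of_bilinear [Finite K] (hK : Nat.card K = p ^ (2 * a)) (ha : 0 < a) {η : K}
    (hη : orderOf η = p ^ a + 1) (b : K →ₗ[ZMod p] K →ₗ[ZMod p] Z) (hb : ∀ x, b x x = 0)
    (hsurj : Function.Surjective (b 1)) (hbη : ∀ x y, b (η * x) (η * y) = b x y) :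
    Nat.card Z ≤ p ^ a := by
  have hp : p.Prime := Fact.out
  have hη0 : η ≠ 0 := by
    rintro rfl
    rw [orderOf_zero] at hη
    omega
  have hinv : η⁻¹ = η ^ p ^ a := by
    rw [inv_eq_iff_eq_inv]
    exact (inv_eq_of_mul_eq_one_right (by rw [← pow_succ, ← hη, pow_orderOf_eq_one])).symm
  have hadj : ∀ c x y, b (c * x) y = b x (c ^ p ^ a * y) := by
    intro c x y
    obtain ⟨Q, rfl⟩ := exists_aeval_eq_of_orderOf_eq hK hη c
    rw [b.apply_aeval_mul_eq (b.apply_mul_eq_inv_mul hη0 hbη), hinv,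
      FiniteField.aeval_pow_pow_char]
  let T : K →ₗ[ZMod p] K :=
    LinearMap.id + ((FiniteField.frobeniusAlgHom (ZMod p) K) ^ a).toLinearMap
  have hT : ∀ c, T c = c + c ^ p ^ a := by
    intro c
    simp only [T, LinearMap.add_apply, LinearMap.id_apply, AlgHom.toLinearMap_apply,
      AlgHom.coe_pow, FiniteField.coe_frobeniusAlgHom, pow_iterate, ZMod.card]
  have hrange : LinearMap.range T ≤ LinearMap.ker (b 1) := by
    rintro _ ⟨c, rfl⟩
    -- Expanding gives `b 1 c + b c 1 = 0`, and `b c 1 = b 1 (c^(p^a))` by adjointness.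
    have h1 := hb (1 + c)
    have h2 := hadj c 1 1
    simp only [map_add, LinearMap.add_apply, hb, zero_add, add_zero] at h1
    rw [mul_one, mul_one] at h2
    rw [LinearMap.mem_ker, hT, map_add, ← h2, add_comm, h1]
  have hker : Nat.card (LinearMap.ker T) ≤ p ^ a := by
    classical
    let Q : K[X] := X ^ p ^ a + X
    have hQd : Q.natDegree = p ^ a := by
      have : 1 < p ^ a := Nat.one_lt_pow ha.ne' hp.one_lt
      rw [natDegree_add_eq_left_of_natDegree_lt] <;> simp [this]
    have hQ0 : Q ≠ 0 := by
      intro h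
      rw [h, natDegree_zero] at hQd
      exact (pow_pos hp.pos a).ne hQd
    have hsub : (LinearMap.ker T : Set K) ⊆ (Q.roots.toFinset : Set K) := by
      intro c hc
      have : T c = 0 := hc
      rw [hT] at this
      simp only [Finset.mem_coe, Multiset.mem_toFinset, mem_roots hQ0, IsRoot.def]
      simpa [Q, add_comm] using this
    calc Nat.card (LinearMap.ker T) = (LinearMap.ker T : Set K).ncard := rfl
      _ ≤ (Q.roots.toFinset : Set K).ncard := Set.ncard_le_ncard hsub (Finset.finite_toSet _)
      _ = Q.roots.toFinset.card := Set.ncard_coe_finset _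
      _ ≤ Q.roots.card := Multiset.toFinset_card_le _
      _ ≤ p ^ a := hQd ▸ Q.card_roots'
  have hfinZ : Finite Z := Finite.of_surjective _ hsurj
  have hKf := finrank_zmod_eq_of_natCard_eq hK
  have h1 := LinearMap.finrank_range_add_finrank_ker T
  have h2 := LinearMap.finrank_range_add_finrank_ker (b 1)
  rw [LinearMap.range_eq_top.mpr hsurj, finrank_top, hKf] at h2
  rw [hKf] at h1
  have h3 := Submodule.finrank_mono hrange
  have h4 : Module.finrank (ZMod p) (LinearMap.ker T) ≤ a := by
    rw [Module.natCard_eq_pow_finrank (K := ZMod p), Nat.card_zmod] at hker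
    exact (Nat.pow_le_pow_iff_right hp.one_lt).mp hker
  rw [Module.natCard_eq_pow_finrank (K := ZMod p) (V := Z), Nat.card_zmod]
  exact Nat.pow_le_pow_right hp.pos (by omega)

/-- An alternating bilinear map on the field with `p ^ (2 * a)` elements that is semi-invariant
under a generator of the multiplicative group and onto in one argument takes values in a space with
`p ^ a` elements. -/
theorem natCard_eq_and_orderOf_eq_of_field_bilinear [Finite K] [Nontrivial Z]
    (hK : Nat.card K = p ^ (2 * a)) {ζ : K} (hζ : orderOf ζ = p ^ (2 * a) - 1)
    (b : K →ₗ[ZMod p] K →ₗ[ZMod p] Z) (hb : ∀ x, b x x = 0)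
    (hsurj : Function.Surjective (b 1)) (t : Module.End (ZMod p) Z)
    (hbt : ∀ x y, b (ζ * x) (ζ * y) = t (b x y)) :
    Nat.card Z = p ^ a ∧ orderOf t = p ^ a - 1 := by
  have hp : p.Prime := Fact.out
  have ha : 0 < a := by
    rcases Nat.eq_zero_or_pos a with rfl | h
    · have := Finite.one_lt_card (α := K)
      simp [hK] at this
    · exact h
  have hpa : 1 < p ^ a := Nat.one_lt_pow ha.ne' hp.one_lt
  have hq : 1 < p ^ (2 * a) := Nat.one_lt_pow (by omega) hp.one_lt
  have hfinZ : Finite Z := Finite.of_surjective _ hsurj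
  have hKf := finrank_zmod_eq_of_natCard_eq hK
  -- The inequality is strict because `b 1 1 = 0`.
  have hm : Module.finrank (ZMod p) Z < 2 * a := by
    have h2 := LinearMap.finrank_range_add_finrank_ker (b 1)
    rw [LinearMap.range_eq_top.mpr hsurj, finrank_top, hKf] at h2
    have h3 : 0 < Module.finrank (ZMod p) (LinearMap.ker (b 1)) := by
      rw [Module.finrank_pos_iff]
      exact ⟨⟨⟨1, hb 1⟩, 0, fun h => one_ne_zero (congrArg Subtype.val h)⟩⟩
    omega
  set μ := minpoly (ZMod p) t with hμ
  have htint : IsIntegral (ZMod p) t := Algebra.IsIntegral.isIntegral t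
  have hμ0 : μ ≠ 0 := minpoly.ne_zero htint
  have hμdeg : μ.natDegree ≤ Module.finrank (ZMod p) Z := by
    rw [← LinearMap.charpoly_natDegree t]
    exact natDegree_le_of_dvd (LinearMap.minpoly_dvd_charpoly t) (LinearMap.charpoly_monic t).ne_zero
  have hroot : ∀ P, Irreducible P → P ∣ μ → orderOf (AdjoinRoot.root P) = p ^ a - 1 := by
    intro P hP hPμ
    have := Fact.mk hP
    obtain ⟨C, hC⟩ := hPμ
    have hC0 : C ≠ 0 := by
      rintro rfl
      exact hμ0 (by rw [hC, mul_zero])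
    -- Applying `C(t)`, with `μ = P * C`, leaves values killed by `P(t)`. The composite is nonzero
    -- because `C` has smaller degree than `μ`.
    refine orderOf_root_eq_of_bilinear hK hζ (b.compr₂ (aeval t C)) ?_ t ?_ P ?_ ?_
    · intro h0
      have h1 : aeval t C = 0 := by
        refine LinearMap.ext fun z => ?_
        obtain ⟨y, rfl⟩ := hsurj z
        exact LinearMap.congr_fun (LinearMap.congr_fun h0 1) y
      have h2 := natDegree_le_of_dvd (minpoly.dvd _ _ h1) hC0
      rw [← hμ, hC, natDegree_mul hP.ne_zero hC0] at h2
      have := hP.natDegree_pos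
      omega
    · intro x y
      have hcomm : aeval t C * t = t * aeval t C := by
        simpa using congrArg (aeval t) (mul_comm C X)
      exact (congrArg (aeval t C) (hbt x y)).trans (LinearMap.congr_fun hcomm _)
    · intro x y
      rw [LinearMap.compr₂_apply, ← Module.End.mul_apply, ← map_mul, ← hC, hμ, minpoly.aeval,
        LinearMap.zero_apply]
    · exact ((natDegree_le_of_dvd ⟨C, hC⟩ hμ0).trans hμdeg).trans_lt hm
  have htq : t ^ (p ^ (2 * a) - 1) = 1 := by
    refine LinearMap.ext fun z => ?_
    obtain ⟨y, rfl⟩ := hsurj z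
    have := b.apply_pow_mul_pow_mul hbt (p ^ (2 * a) - 1) 1 y
    rw [← hζ, pow_orderOf_eq_one, one_mul, one_mul, hζ] at this
    exact this.symm
  have hsqf : Squarefree μ := by
    -- Separable because the exponent is `-1` modulo `p`.
    have hsep : (X ^ (p ^ (2 * a) - 1) - 1 : (ZMod p)[X]).Separable := by
      rw [X_pow_sub_one_separable_iff, Nat.cast_sub hq.le]
      simp [ha.ne']
    refine hsep.squarefree.squarefree_of_dvd (minpoly.dvd _ _ ?_)
    simp [htq]
  have hdvd : μ ∣ X ^ (p ^ a - 1) - 1 :=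
    Polynomial.dvd_of_squarefree_of_forall_irreducible_dvd hsqf hμ0 fun P hP hPμ => by
      rw [← AdjoinRoot.root_pow_eq_one_iff, ← hroot P hP hPμ, pow_orderOf_eq_one]
  have ht1 : t ^ (p ^ a - 1) = 1 := by
    have := (minpoly.dvd_iff).mp hdvd
    simpa [sub_eq_zero] using this
  obtain ⟨P, hP, hPμ⟩ := WfDvdMonoid.exists_irreducible_factor (minpoly.not_isUnit (ZMod p) t) hμ0
  have hPord := hroot P hP hPμ
  constructor
  · refine le_antisymm ?_ ?_
    · have hη : orderOf (ζ ^ (p ^ a - 1)) = p ^ a + 1 := by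
        rw [orderOf_pow_of_dvd (by omega) (by rw [hζ, Nat.pow_two_mul_sub_one]; exact dvd_mul_right _ _),
          hζ, Nat.pow_two_mul_sub_one, Nat.mul_div_cancel_left _ (by omega)]
      refine natCard_le_of_bilinear hK ha hη b hb hsurj fun x y => ?_
      rw [b.apply_pow_mul_pow_mul hbt, ht1, Module.End.one_apply]
    -- A root of order `p^a - 1` lies in a field with `p^(deg P)` elements, so `a ≤ deg P ≤ dim Z`.
    · have := Fact.mk hP
      have hcard := AdjoinRoot.natCard_zmod P hP.ne_zero
      have hfinE : Finite (AdjoinRoot P) := Nat.finite_of_card_ne_zero (by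
        rw [hcard]; exact pow_ne_zero _ hp.ne_zero)
      have hw0 : AdjoinRoot.root P ≠ 0 := by
        intro h
        rw [h, orderOf_zero] at hPord
        omega
      have h1 := orderOf_dvd_natCard_sub_one hw0
      rw [hcard, hPord] at h1
      have h2 : 1 < p ^ P.natDegree := Nat.one_lt_pow hP.natDegree_pos.ne' hp.one_lt
      have h3 := Nat.le_of_dvd (by omega) h1
      rw [Module.natCard_eq_pow_finrank (K := ZMod p) (V := Z), Nat.card_zmod]
      calc p ^ a ≤ p ^ P.natDegree := by omega
        _ ≤ _ := Nat.pow_le_pow_right hp.pos ((natDegree_le_of_dvd hPμ hμ0).trans hμdeg)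
  · refine Nat.dvd_antisymm (orderOf_dvd_of_pow_eq_one ht1) ?_
    rw [← hPord]
    refine orderOf_dvd_of_pow_eq_one ?_
    rw [AdjoinRoot.root_pow_eq_one_iff]
    refine hPμ.trans (minpoly.dvd _ _ ?_)
    simp [pow_orderOf_eq_one]

end

end BilinearMaps

/-! ### The field generated by a Singer cycle. -/

section SingerCycles

open Polynomial

variable {p a n : ℕ} [Fact p.Prime] {V Z : Type*} [AddCommGroup V] [Module (ZMod p) V] [Finite V]
  [AddCommGroup Z] [Module (ZMod p) Z]

/-- By Cayley–Hamilton, polynomials in `s` may be reduced modulo the characteristic polynomial, of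
degree `n`. -/
theorem natCard_adjoin_singleton_le (hV : Nat.card V = p ^ n) (s : Module.End (ZMod p) V) :
    Nat.card (Algebra.adjoin (ZMod p) {s}) ≤ p ^ n := by
  have hp : p.Prime := Fact.out
  have hmonic := LinearMap.charpoly_monic s
  have hdeg : s.charpoly.natDegree = n := by
    rw [LinearMap.charpoly_natDegree, finrank_zmod_eq_of_natCard_eq hV]
  have hle : Subalgebra.toSubmodule (Algebra.adjoin (ZMod p) {s}) ≤
      (degreeLT (ZMod p) n).map (aeval s).toLinearMap := by
    intro f hf
    rw [Subalgebra.mem_toSubmodule, Algebra.adjoin_singleton_eq_range_aeval] at hf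
    obtain ⟨Q, rfl⟩ := hf
    refine ⟨Q %ₘ s.charpoly, ?_, ?_⟩
    · rw [SetLike.mem_coe, mem_degreeLT, ← hdeg, ← degree_eq_natDegree hmonic.ne_zero]
      exact degree_modByMonic_lt Q hmonic
    · exact aeval_modByMonic_eq_self_of_root (LinearMap.aeval_self_charpoly s)
  have hfr : Module.finrank (ZMod p) (degreeLT (ZMod p) n) = n := by
    rw [(degreeLTEquiv (ZMod p) n).finrank_eq, Module.finrank_fin_fun]
  have : Module.Finite (ZMod p) (degreeLT (ZMod p) n) :=
    Module.Finite.equiv (degreeLTEquiv (ZMod p) n).symm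
  have h1 : Module.finrank (ZMod p) (Algebra.adjoin (ZMod p) {s}) ≤ n :=
    (Submodule.finrank_mono hle).trans ((Submodule.finrank_map_le _ _).trans hfr.le)
  rw [Module.natCard_eq_pow_finrank (K := ZMod p), Nat.card_zmod]
  exact Nat.pow_le_pow_right hp.pos h1

/-- A linear map of order `p ^ n - 1` on a space with `p ^ n` elements has the property that every
nonzero element of the algebra it generates is one of its powers. -/
theorem exists_pow_eq_of_mem_adjoin_singleton (hn : 0 < n) (hV : Nat.card V = p ^ n)
    {s : Module.End (ZMod p) V} (hs : orderOf s = p ^ n - 1) {f : Module.End (ZMod p) V}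
    (hf : f ∈ Algebra.adjoin (ZMod p) {s}) (hf0 : f ≠ 0) : ∃ i : ℕ, s ^ i = f := by
  classical
  have hp : p.Prime := Fact.out
  have hpn : 1 < p ^ n := Nat.one_lt_pow hn.ne' hp.one_lt
  have hs1 : s ^ (p ^ n - 1) = 1 := hs ▸ pow_orderOf_eq_one s
  have hne : Nontrivial V := Finite.one_lt_card_iff_nontrivial.mp (hV ▸ hpn)
  let A : Set (Module.End (ZMod p) V) := (Algebra.adjoin (ZMod p) {s} : Set _)
  have hfin : Finite (Module.End (ZMod p) V) := Module.finite_of_finite (ZMod p)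
  let P : Finset (Module.End (ZMod p) V) := (Finset.range (p ^ n - 1)).image (s ^ ·)
  have hPcard : P.card = p ^ n - 1 := by
    rw [Finset.card_image_of_injOn, Finset.card_range]
    intro i hi j hj hij
    rw [← hs] at hi hj
    exact pow_injOn_Iio_orderOf (by simpa using hi) (by simpa using hj) hij
  have h0P : (0 : Module.End (ZMod p) V) ∉ P := by
    intro h
    obtain ⟨i, hi, hi0⟩ := Finset.mem_image.mp h
    have h1 : s ^ (p ^ n - 1) = 0 := by
      rw [← Nat.add_sub_cancel' (Finset.mem_range.mp hi).le, pow_add]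
      exact mul_eq_zero_of_left hi0 _
    exact one_ne_zero (hs1.symm.trans h1)
  have hsub : ((insert 0 P : Finset _) : Set (Module.End (ZMod p) V)) ⊆ A := by
    intro g hg
    rw [Finset.coe_insert, Set.mem_insert_iff, Finset.mem_coe] at hg
    rcases hg with rfl | hg
    · exact zero_mem (Algebra.adjoin (ZMod p) {s})
    · obtain ⟨i, -, rfl⟩ := Finset.mem_image.mp hg
      exact pow_mem (Algebra.self_mem_adjoin_singleton _ _) i
  -- Zero and the `p^n - 1` distinct powers of `s` already exhaust the bound on the size of the
  -- algebra.
  have heq : ((insert 0 P : Finset _) : Set (Module.End (ZMod p) V)) = A := by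
    refine Set.eq_of_subset_of_ncard_le hsub ?_ (Set.toFinite _)
    rw [Set.ncard_coe_finset, Finset.card_insert_of_notMem h0P, hPcard, Nat.sub_add_cancel hpn.le]
    exact natCard_adjoin_singleton_le hV s
  have hfA : f ∈ ((insert 0 P : Finset _) : Set (Module.End (ZMod p) V)) := heq ▸ hf
  rw [Finset.coe_insert, Set.mem_insert_iff, Finset.mem_coe] at hfA
  rcases hfA with rfl | hfP
  · exact absurd rfl hf0
  · obtain ⟨i, -, hi⟩ := Finset.mem_image.mp hfP
    exact ⟨i, hi⟩

/-- An alternating bilinear map on a space with `p ^ (2 * a)` elements that is semi-invariant under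
a linear map of order `p ^ (2 * a) - 1`, and onto in each argument, takes values in a space with
`p ^ a` elements. -/
theorem natCard_eq_and_orderOf_eq_of_bilinear [Nontrivial Z] (hV : Nat.card V = p ^ (2 * a))
    {s : Module.End (ZMod p) V} (hs : orderOf s = p ^ (2 * a) - 1)
    (B : V →ₗ[ZMod p] V →ₗ[ZMod p] Z) (hB : ∀ v, B v v = 0)
    (hsurj : ∀ v, v ≠ 0 → Function.Surjective (B v)) (t : Module.End (ZMod p) Z)
    (hBt : ∀ v w, B (s v) (s w) = t (B v w)) (ha : 0 < a) :
    Nat.card Z = p ^ a ∧ orderOf t = p ^ a - 1 := by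
  have hp : p.Prime := Fact.out
  have hq : 1 < p ^ (2 * a) := Nat.one_lt_pow (by omega) hp.one_lt
  have hne : Nontrivial V := Finite.one_lt_card_iff_nontrivial.mp (hV ▸ hq)
  have hs1 : s ^ (p ^ (2 * a) - 1) = 1 := hs ▸ pow_orderOf_eq_one s
  have hpow := fun f => exists_pow_eq_of_mem_adjoin_singleton (f := f) (by omega) hV hs
  have hunit : ∀ i : ℕ, ∃ j : ℕ, s ^ i * s ^ j = 1 := fun i =>
    ⟨i * (p ^ (2 * a) - 1) - i, by
      rw [← pow_add, Nat.add_sub_cancel' (Nat.le_mul_of_pos_right _ (by omega)), mul_comm, pow_mul,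
        hs1, one_pow]⟩
  let S := Algebra.adjoin (ZMod p) {s}
  let ζ : S := ⟨s, Algebra.self_mem_adjoin_singleton _ _⟩
  have hfield : IsField S :=
    { exists_pair_ne := ⟨0, 1, zero_ne_one⟩
      mul_comm := mul_comm
      mul_inv_cancel := by
        intro f hf
        obtain ⟨i, hi⟩ := hpow f f.2 (fun h => hf (Subtype.ext h))
        obtain ⟨j, hj⟩ := hunit i
        exact ⟨ζ ^ j, Subtype.ext (by simpa [← hi, ζ] using hj)⟩ }
  let _ : Field S := hfield.toField
  have hfinE : Finite (Module.End (ZMod p) V) := Module.finite_of_finite (ZMod p)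
  obtain ⟨v₀, hv₀⟩ := exists_ne (0 : V)
  -- Evaluation at `v₀` identifies the field with `V`: it is injective because nonzero elements are
  -- invertible, and the cardinalities agree.
  let ev : S →ₗ[ZMod p] V := (LinearMap.applyₗ v₀) ∘ₗ S.val.toLinearMap
  have hev : ∀ f : S, ev f = (f : Module.End (ZMod p) V) v₀ := fun _ => rfl
  have hinj : Function.Injective ev := by
    rw [injective_iff_map_eq_zero]
    intro f hf
    by_contra hf0
    obtain ⟨i, hi⟩ := hpow f f.2 (fun h => hf0 (Subtype.ext h))
    obtain ⟨j, hj⟩ := hunit i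
    rw [← pow_add, add_comm, pow_add, hi] at hj
    have := LinearMap.congr_fun hj v₀
    rw [Module.End.mul_apply, ← hev, hf, map_zero] at this
    exact hv₀ this.symm
  have hζ : orderOf ζ = p ^ (2 * a) - 1 := by
    rw [← hs, ← orderOf_injective (S.val : S →* Module.End (ZMod p) V) Subtype.val_injective]
    rfl
  have hS : Nat.card S = p ^ (2 * a) := by
    refine le_antisymm (natCard_adjoin_singleton_le hV s) ?_
    have h0 : ζ ≠ 0 := by
      intro h
      rw [h, orderOf_zero] at hζ
      have h4 : 2 ^ 2 ≤ p ^ (2 * a) := (Nat.pow_le_pow_left hp.two_le 2).trans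
        (Nat.pow_le_pow_right hp.pos (by omega))
      omega
    have h1 := orderOf_dvd_natCard_sub_one h0
    have h2 := Finite.one_lt_card (α := S)
    have h3 := Nat.le_of_dvd (by omega) h1
    omega
  have hbij : Function.Bijective ev :=
    (Nat.bijective_iff_injective_and_card ev).mpr ⟨hinj, hS.trans hV.symm⟩
  refine natCard_eq_and_orderOf_eq_of_field_bilinear hS hζ (B.compl₁₂ ev ev) (fun f => hB _) ?_ t
    fun f g => hBt _ _
  exact (hsurj _ (fun h => one_ne_zero (hinj (h.trans (map_zero ev).symm)))).comp hbij.2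

end SingerCycles

/-! ### Semi-extraspecial groups and their commutator pairing. -/

section SemiExtraspecialGroups

open Subgroup
open scoped commutatorElement IsMulCommutative

theorem Subgroup.zpowers_eq_of_natCard_prime {G : Type*} [Group G] {p : ℕ} (hp : p.Prime)
    {H : Subgroup G} (hH : Nat.card H = p) {c : G} (hc : c ∈ H) (hc1 : c ≠ 1) : zpowers c = H := by
  have hle : zpowers c ≤ H := zpowers_le.mpr hc
  have : Finite H := Nat.finite_of_card_ne_zero (hH ▸ hp.ne_zero)
  refine eq_of_le_of_card_ge hle ?_
  have hdvd := card_dvd_of_le hle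
  rw [hH, Nat.dvd_prime hp] at hdvd
  rcases hdvd with h | h
  · rw [Nat.card_zpowers, orderOf_eq_one_iff] at h
    exact absurd h hc1
  · rw [hH, h]

/-- The number of points of `H` fixed under conjugation by a `p`-group is divisible by `p`, so `1`
is not the only one. -/
theorem IsPGroup.exists_mem_center_of_normal_card_eq {p : ℕ} (hp : p.Prime) {G : Type*} [Group G]
    [Finite G] (hG : IsPGroup p G) {H : Subgroup G} [H.Normal] (hH : Nat.card H = p) :
    ∃ c ∈ H, c ∈ center G ∧ c ≠ 1 := by
  have := Fact.mk hp
  have hG' : IsPGroup p (ConjAct G) := hG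
  have h1 : (1 : H) ∈ MulAction.fixedPoints (ConjAct G) H := fun g => smul_one g
  obtain ⟨c, hc, hc1⟩ :=
    hG'.exists_fixed_point_of_prime_dvd_card_of_fixed_point H (dvd_of_eq hH.symm) h1
  refine ⟨c, c.2, ?_, fun h => hc1 (Subtype.ext h.symm)⟩
  rw [mem_center_iff]
  intro g
  have := congrArg Subtype.val (hc (ConjAct.toConjAct g))
  rw [ConjAct.Subgroup.val_conj_smul, ConjAct.smul_def, ConjAct.ofConjAct_toConjAct] at this
  exact mul_inv_eq_iff_eq_mul.mp this

theorem IsExtraspecial.commutator_eq_center {p : ℕ} (hp : p.Prime) {G : Type*} [Group G] [Finite G]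
    (hG : IsExtraspecial p G) : commutator G = center G := by
  obtain ⟨c, hc, hcz, hc1⟩ := hG.1.exists_mem_center_of_normal_card_eq hp hG.2.1
  rw [← zpowers_eq_of_natCard_prime hp hG.2.1 hc hc1, zpowers_eq_of_natCard_prime hp hG.2.2 hcz hc1]

section

variable {p : ℕ} {G : Type*} [Group G]

theorem Subgroup.normal_of_le_center {N : Subgroup G} (hN : N ≤ center G) : N.Normal :=
  ⟨fun n hn g => by rwa [mem_center_iff.mp (hN hn) g, mul_inv_cancel_right]⟩

/-- The center of `G ⧸ N` is the image of the center of `G`, when `N` is maximal in the center of a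
semi-extraspecial group `G`. -/
theorem IsSemiExtraspecial.mk_mem_center_iff (hp : p.Prime) (hG : IsSemiExtraspecial p G)
    {N : Subgroup G} [N.Normal] (hN : N ⋖ center G) (x : G) :
    (x : G ⧸ N) ∈ center (G ⧸ N) ↔ x ∈ center G := by
  have hmk : ∀ z ∈ center G, (z : G ⧸ N) ∈ center (G ⧸ N) := by
    intro z hz
    rw [mem_center_iff]
    intro g
    obtain ⟨g, rfl⟩ := QuotientGroup.mk_surjective g
    rw [← QuotientGroup.mk_mul, ← QuotientGroup.mk_mul, mem_center_iff.mp hz g]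
  refine ⟨fun hx => ?_, hmk x⟩
  -- The image of any `z` in `Z(G)` outside `N` generates the center of `G/N`, which has order `p`.
  obtain ⟨z, hz, hzN⟩ := SetLike.exists_of_lt hN.lt
  have hz1 : (z : G ⧸ N) ≠ 1 := fun h => hzN ((QuotientGroup.eq_one_iff z).mp h)
  rw [← zpowers_eq_of_natCard_prime hp (hG.2 N hN).2.2 (hmk z hz) hz1] at hx
  obtain ⟨k, hk⟩ := mem_zpowers_iff.mp hx
  rw [← QuotientGroup.mk_zpow, QuotientGroup.eq] at hk
  have := mul_mem (zpow_mem hz k) (hN.le hk)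
  rwa [mul_inv_cancel_left] at this

/-- The homomorphism `y ↦ ⁅x, y⁆` to the center of a group of class two. -/
def commutatorHom (h : ∀ x y : G, ⁅x, y⁆ ∈ center G) (x : G) : G →* center G where
  toFun y := ⟨⁅x, y⁆, h x y⟩
  map_one' := Subtype.ext (commutatorElement_one_right x)
  map_mul' y z := Subtype.ext (by
    refine (commutatorElement_mul_right_eq_mul_conj x y z).trans ?_
    rw [mul_assoc _ y, mem_center_iff.mp (h x z) y, mul_assoc, mul_inv_cancel_right, coe_mul])

theorem coe_commutatorHom_apply (h : ∀ x y : G, ⁅x, y⁆ ∈ center G) (x y : G) :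
    (commutatorHom h x y : G) = ⁅x, y⁆ := rfl

theorem commutatorHom_mul (h : ∀ x y : G, ⁅x, y⁆ ∈ center G) (x y : G) :
    commutatorHom h (x * y) = commutatorHom h x * commutatorHom h y :=
  MonoidHom.ext fun z => Subtype.ext (by
    rw [MonoidHom.mul_apply, coe_mul, coe_commutatorHom_apply, coe_commutatorHom_apply,
      coe_commutatorHom_apply, commutatorElement_mul_left_eq_conj_mul,
      mem_center_iff.mp (h y z) x, mul_inv_cancel_right, mem_center_iff.mp (h y z)])

theorem commutatorHom_eq_one_of_mem_center (h : ∀ x y : G, ⁅x, y⁆ ∈ center G) {x : G}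
    (hx : x ∈ center G) : commutatorHom h x = 1 :=
  MonoidHom.ext fun y => Subtype.ext
    (commutatorElement_eq_one_iff_mul_comm.mpr (mem_center_iff.mp hx y).symm)

/-- The commutator map of a group of class two, as a bimultiplicative map on the central
quotient. -/
def commutatorPairing (h : ∀ x y : G, ⁅x, y⁆ ∈ center G) :
    G ⧸ center G →* (G ⧸ center G →* center G) :=
  QuotientGroup.lift (center G)
    { toFun := fun x => QuotientGroup.lift (center G) (commutatorHom h x) fun z hz => by
        rw [MonoidHom.mem_ker]
        exact Subtype.ext (commutatorElement_eq_one_iff_mul_comm.mpr (mem_center_iff.mp hz x))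
      map_one' := by
        ext y
        simp [commutatorHom_eq_one_of_mem_center h (one_mem _)]
      map_mul' := fun x y => by
        ext z
        simp [commutatorHom_mul] }
    fun z hz => by
      rw [MonoidHom.mem_ker]
      ext y
      simp [commutatorHom_eq_one_of_mem_center h hz]

theorem coe_commutatorPairing_mk (h : ∀ x y : G, ⁅x, y⁆ ∈ center G) (x y : G) :
    (commutatorPairing h (x : G ⧸ center G) (y : G ⧸ center G) : G) = ⁅x, y⁆ := rfl

theorem MulAut.quotientCenter_pow (σ : MulAut G) (n : ℕ) :
    (σ ^ n).quotientCenter = σ.quotientCenter ^ n := by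
  induction n with
  | zero =>
    ext x
    obtain ⟨x, rfl⟩ := QuotientGroup.mk_surjective x
    rfl
  | succ n ih =>
    rw [pow_succ, pow_succ, ← ih]
    ext x
    obtain ⟨x, rfl⟩ := QuotientGroup.mk_surjective x
    rfl

variable [Finite G]

theorem Subgroup.exists_normal_covBy_center_of_lt {H : Subgroup G} (hH : H < center G) :
    ∃ N : Subgroup G, N.Normal ∧ H ≤ N ∧ N ⋖ center G := by
  obtain ⟨N, hHN, hN⟩ := exists_le_covBy_of_lt hH
  exact ⟨N, normal_of_le_center hN.le, hHN, hN⟩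

theorem IsSemiExtraspecial.bot_lt_center (hp : p.Prime) (hG : IsSemiExtraspecial p G)
    (hc : center G ≠ ⊤) : ⊥ < center G := by
  have := Fact.mk hp
  have : Nontrivial G := by
    by_contra h
    rw [not_nontrivial_iff_subsingleton] at h
    exact hc (Subsingleton.elim _ _)
  exact hG.1.bot_lt_center

theorem IsSemiExtraspecial.commutatorElement_mem_center (hp : p.Prime)
    (hG : IsSemiExtraspecial p G) (hc : center G ≠ ⊤) (x y : G) : ⁅x, y⁆ ∈ center G := by
  obtain ⟨N, _, -, hN⟩ := exists_normal_covBy_center_of_lt (hG.bot_lt_center hp hc)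
  rw [← hG.mk_mem_center_iff hp hN, ← (hG.2 N hN).commutator_eq_center hp]
  exact commutator_mem_commutator (mem_top (x : G ⧸ N)) (mem_top (y : G ⧸ N))

/-- A proper image would lie in some maximal `N < Z(G)`, making `x` central modulo `N` and hence
central. -/
theorem IsSemiExtraspecial.commutatorHom_surjective (hp : p.Prime) (hG : IsSemiExtraspecial p G)
    (h : ∀ x y : G, ⁅x, y⁆ ∈ center G) {x : G} (hx : x ∉ center G) :
    Function.Surjective (commutatorHom h x) := by
  by_contra hns
  have hlt : Subgroup.map (center G).subtype (commutatorHom h x).range < center G := by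
    refine lt_of_le_of_ne (map_subtype_le _) fun heq => hns ?_
    intro z
    have hz := heq.ge z.2
    obtain ⟨_, ⟨y, rfl⟩, hy⟩ := hz
    exact ⟨y, Subtype.ext hy⟩
  obtain ⟨N, _, hle, hN⟩ := exists_normal_covBy_center_of_lt hlt
  refine hx ((hG.mk_mem_center_iff hp hN x).mp (mem_center_iff.mpr fun y => ?_))
  obtain ⟨y, rfl⟩ := QuotientGroup.mk_surjective y
  rw [eq_comm, ← commutatorElement_eq_one_iff_mul_comm]
  exact (QuotientGroup.eq_one_iff ⁅x, y⁆).mpr (hle ⟨_, ⟨y, rfl⟩, rfl⟩)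

theorem IsSemiExtraspecial.pow_mem_center (hp : p.Prime) (hG : IsSemiExtraspecial p G)
    (hc : center G ≠ ⊤) (x : G) : x ^ p ∈ center G := by
  have h := hG.commutatorElement_mem_center hp hc
  obtain ⟨N, _, -, hN⟩ := exists_normal_covBy_center_of_lt (hG.bot_lt_center hp hc)
  rw [← hG.mk_mem_center_iff hp hN, mem_center_iff]
  intro y
  obtain ⟨y, rfl⟩ := QuotientGroup.mk_surjective y
  rw [← commutatorElement_eq_one_iff_mul_comm]
  -- Here `⁅y, x^p⁆ = ⁅y, x⁆^p`, a `p`-th power in a center of order `p` modulo `N`.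
  change ((⁅y, x ^ p⁆ : G) : G ⧸ N) = 1
  rw [← coe_commutatorHom_apply h, map_pow, coe_pow, QuotientGroup.mk_pow]
  have hmem := (hG.mk_mem_center_iff hp hN _).mpr (commutatorHom h y x).2
  have := pow_card_eq_one' (G := center (G ⧸ N)) (x := ⟨_, hmem⟩)
  rw [(hG.2 N hN).2.2] at this
  exact congrArg Subtype.val this

/-- Every central element is a commutator `⁅x, y⁆`, and `⁅x, y⁆^p = ⁅x, y^p⁆ = 1`. -/
theorem IsSemiExtraspecial.center_pow_eq_one (hp : p.Prime) (hG : IsSemiExtraspecial p G)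
    (hc : center G ≠ ⊤) (z : center G) : z ^ p = 1 := by
  have h := hG.commutatorElement_mem_center hp hc
  obtain ⟨x, hx⟩ : ∃ x, x ∉ center G := by
    by_contra! hall
    exact hc (eq_top_iff.mpr fun x _ => hall x)
  obtain ⟨y, rfl⟩ := hG.commutatorHom_surjective hp h hx z
  rw [← map_pow]
  exact Subtype.ext (commutatorElement_eq_one_iff_mul_comm.mpr
    (mem_center_iff.mp (hG.pow_mem_center hp hc y) x))

/-- An automorphism of a semi-extraspecial group that is trivial on the central quotient has
order dividing `p`. -/
theorem IsSemiExtraspecial.pow_eq_one_of_quotientCenter_eq_one (hp : p.Prime)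
    (hG : IsSemiExtraspecial p G) (hc : center G ≠ ⊤) {σ : MulAut G}
    (hσ : σ.quotientCenter = 1) : σ ^ p = 1 := by
  have h := hG.commutatorElement_mem_center hp hc
  have hdiff : ∀ x, x⁻¹ * σ x ∈ center G := fun x => by
    have := DFunLike.congr_fun hσ (x : G ⧸ center G)
    rw [MulAut.quotientCenter_mk, MulAut.one_apply] at this
    exact QuotientGroup.eq.mp this.symm
  -- Commutators depend only on cosets of the center, which `σ` fixes, and they fill the center.
  have hσz : ∀ z ∈ center G, σ z = z := by
    intro z hz
    obtain ⟨x, hx⟩ : ∃ x, x ∉ center G := by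
      by_contra! hall
      exact hc (eq_top_iff.mpr fun x _ => hall x)
    obtain ⟨y, hy⟩ := hG.commutatorHom_surjective hp h hx ⟨z, hz⟩
    have hy' : ⁅x, y⁆ = z := congrArg Subtype.val hy
    rw [← hy', map_commutatorElement, ← coe_commutatorPairing_mk h, ← coe_commutatorPairing_mk h,
      ← QuotientGroup.eq.mpr (hdiff x), ← QuotientGroup.eq.mpr (hdiff y)]
  have hpow : ∀ (n : ℕ) (x : G), (σ ^ n) x = x * (x⁻¹ * σ x) ^ n := by
    intro n x
    induction n with
    | zero => simp
    | succ n ih =>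
      rw [pow_succ', MulAut.mul_apply, ih, map_mul, hσz _ (pow_mem (hdiff x) n), pow_succ',
        ← mul_assoc, mul_inv_cancel_left]
  ext x
  rw [hpow, MulAut.one_apply]
  have := congrArg Subtype.val (hG.center_pow_eq_one hp hc ⟨_, hdiff x⟩)
  simp only [coe_pow, coe_one] at this
  rw [this, mul_one]

/-- The kernel of the action on the central quotient has exponent dividing `p`, so an order prime to
`p` is not reduced. -/
theorem IsSemiExtraspecial.orderOf_quotientCenter (hp : p.Prime) (hG : IsSemiExtraspecial p G)
    (hc : center G ≠ ⊤) {σ : MulAut G} (hσ : (orderOf σ).Coprime p) :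
    orderOf σ.quotientCenter = orderOf σ := by
  refine Nat.dvd_antisymm (orderOf_dvd_of_pow_eq_one ?_) ?_
  · rw [← MulAut.quotientCenter_pow, pow_orderOf_eq_one]
    exact MulAut.quotientCenter_pow (1 : MulAut G) 0
  · refine hσ.dvd_of_dvd_mul_right (orderOf_dvd_of_pow_eq_one ?_)
    rw [pow_mul]
    refine hG.pow_eq_one_of_quotientCenter_eq_one hp hc ?_
    rw [MulAut.quotientCenter_pow, pow_orderOf_eq_one]

end

section

variable {p : ℕ}

/-- Additive endomorphisms of an elementary abelian group as linear maps. -/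
def AddMonoid.End.toZModEnd (p : ℕ) (V : Type*) [AddCommGroup V] [Module (ZMod p) V] :
    AddMonoid.End V →* Module.End (ZMod p) V where
  toFun e := AddMonoidHom.toZModLinearMap p e
  map_one' := rfl
  map_mul' _ _ := rfl

theorem AddMonoid.End.toZModEnd_injective (p : ℕ) (V : Type*) [AddCommGroup V]
    [Module (ZMod p) V] : Function.Injective (AddMonoid.End.toZModEnd p V) := fun _ _ h =>
  AddMonoidHom.ext fun v => LinearMap.congr_fun h v

theorem natCard_eq_and_orderOf_eq_of_biadditive [Fact p.Prime] {a : ℕ} (ha : 0 < a)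
    {V Z : Type*} [AddCommGroup V] [AddCommGroup Z] [Module (ZMod p) V] [Module (ZMod p) Z]
    [Finite V] [Nontrivial Z] (hV : Nat.card V = p ^ (2 * a)) (Φ : V →+ V →+ Z)
    (hΦ : ∀ v, Φ v v = 0) (hsurj : ∀ v, v ≠ 0 → Function.Surjective (Φ v)) {s : AddMonoid.End V}
    (hs : orderOf s = p ^ (2 * a) - 1) (t : AddMonoid.End Z)
    (hst : ∀ v w, Φ (s v) (s w) = t (Φ v w)) :
    Nat.card Z = p ^ a ∧ orderOf t = p ^ a - 1 := by
  let B : V →ₗ[ZMod p] V →ₗ[ZMod p] Z :=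
    LinearMap.mk₂ (ZMod p) (fun v w => Φ v w)
      (fun u v w => DFunLike.congr_fun (map_add Φ u v) w)
      (fun c v w => ZMod.map_smul (Φ.flip w) c v)
      (fun u v w => map_add (Φ u) v w)
      (fun c v w => ZMod.map_smul (Φ v) c w)
  rw [← orderOf_injective _ (AddMonoid.End.toZModEnd_injective p V)] at hs
  rw [← orderOf_injective _ (AddMonoid.End.toZModEnd_injective p Z)]
  exact natCard_eq_and_orderOf_eq_of_bilinear hV hs B hΦ hsurj _ hst ha

/-- Automorphisms of a group as endomorphisms of the additive group. -/
def MulAut.toAdditiveEnd (V : Type*) [Group V] : MulAut V →* AddMonoid.End (Additive V) where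
  toFun e := MonoidHom.toAdditive e.toMonoidHom
  map_one' := rfl
  map_mul' _ _ := rfl

theorem MulAut.toAdditiveEnd_injective (V : Type*) [Group V] :
    Function.Injective (MulAut.toAdditiveEnd V) := fun _ _ h =>
  MulEquiv.ext fun v => DFunLike.congr_fun h (Additive.ofMul v)

theorem natCard_eq_and_orderOf_eq_of_pairing (hp : p.Prime) {a : ℕ} (ha : 0 < a) {V Z : Type*}
    [CommGroup V] [CommGroup Z] [Finite V] [Nontrivial Z] (hV : Nat.card V = p ^ (2 * a))
    (hVp : ∀ v : V, v ^ p = 1) (hZp : ∀ z : Z, z ^ p = 1) (Φ : V →* V →* Z)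
    (hΦ : ∀ v, Φ v v = 1) (hsurj : ∀ v, v ≠ 1 → Function.Surjective (Φ v)) {s : MulAut V}
    (hs : orderOf s = p ^ (2 * a) - 1) (t : MulAut Z) (hst : ∀ v w, Φ (s v) (s w) = t (Φ v w)) :
    Nat.card Z = p ^ a ∧ orderOf t = p ^ a - 1 := by
  let B : Additive V →+ Additive V →+ Additive Z :=
    { toFun := fun v => MonoidHom.toAdditive (Φ v.toMul)
      map_zero' := AddMonoidHom.ext fun w => DFunLike.congr_fun (map_one Φ) w.toMul
      map_add' := fun u v =>
        AddMonoidHom.ext fun w => DFunLike.congr_fun (map_mul Φ u.toMul v.toMul) w.toMul }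
  rw [← orderOf_injective _ (MulAut.toAdditiveEnd_injective V)] at hs
  rw [← orderOf_injective _ (MulAut.toAdditiveEnd_injective Z)]
  have := Fact.mk hp
  let _ : Module (ZMod p) (Additive V) := AddCommGroup.zmodModule hVp
  let _ : Module (ZMod p) (Additive Z) := AddCommGroup.zmodModule hZp
  exact natCard_eq_and_orderOf_eq_of_biadditive (V := Additive V) (Z := Additive Z) ha hV B hΦ
    hsurj hs _ hst

end

theorem mainTheorem3 (p : ℕ) (hp : p.Prime) (G : Type*) [Group G] [Finite G]
    (hG : IsSemiExtraspecial p G) (a : ℕ)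
    (ha : (Subgroup.center G).index = p ^ (2 * a))
    (σ : MulAut G) (hσ : orderOf σ = p ^ (2 * a) - 1) :
    (IsUltraspecial p G ∧ Nat.card (Subgroup.center G) = p ^ a) ∧
      (orderOf σ.restrictCenter = Nat.card (Subgroup.center G) - 1 ∧
        Nat.card (Subgroup.center G) - 1 = p ^ a - 1) ∧
      orderOf (σ ^ (p ^ a - 1)).quotientCenter = p ^ a + 1 := by
  -- For `a = 0` the prescribed order is `0`, that is, infinite order, impossible in a finite group.
  have ha0 : 0 < a := by
    rcases Nat.eq_zero_or_pos a with rfl | h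
    · have := Finite.of_injective (fun τ : MulAut G => (τ : G → G)) DFunLike.coe_injective
      have := orderOf_pos σ
      simp [hσ] at this
    · exact h
  have hpa : 1 < p ^ a := Nat.one_lt_pow ha0.ne' hp.one_lt
  have hq : 1 < p ^ (2 * a) := Nat.one_lt_pow (by omega) hp.one_lt
  have hc : center G ≠ ⊤ := by
    intro h
    rw [h, index_top] at ha
    omega
  have hcomm := hG.commutatorElement_mem_center hp hc
  have hcop : (orderOf σ).Coprime p := by
    rw [hσ]
    refine Nat.Coprime.coprime_dvd_right (dvd_pow_self p (by omega : 2 * a ≠ 0)) ?_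
    exact (Nat.coprime_self_sub_left hq.le).mpr (Nat.coprime_one_left _)
  have hσV : orderOf σ.quotientCenter = p ^ (2 * a) - 1 :=
    (hG.orderOf_quotientCenter hp hc hcop).trans hσ
  let _ : CommGroup (G ⧸ center G) :=
    { (inferInstance : Group (G ⧸ center G)) with
      mul_comm := fun x y => by
        obtain ⟨x, rfl⟩ := QuotientGroup.mk_surjective x
        obtain ⟨y, rfl⟩ := QuotientGroup.mk_surjective y
        rw [← commutatorElement_eq_one_iff_mul_comm]
        exact (QuotientGroup.eq_one_iff ⁅x, y⁆).mpr (hcomm x y) }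
  have hZ : Nontrivial (center G) :=
    (nontrivial_iff_ne_bot _).mpr (hG.bot_lt_center hp hc).ne'
  have hmain : Nat.card (center G) = p ^ a ∧ orderOf σ.restrictCenter = p ^ a - 1 := by
    refine natCard_eq_and_orderOf_eq_of_pairing (V := G ⧸ center G) hp ha0 ha ?_
      (hG.center_pow_eq_one hp hc) (commutatorPairing hcomm) ?_ ?_ hσV σ.restrictCenter ?_
    · intro x
      obtain ⟨x, rfl⟩ := QuotientGroup.mk_surjective x
      exact (QuotientGroup.eq_one_iff (x ^ p)).mpr (hG.pow_mem_center hp hc x)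
    · intro x
      obtain ⟨x, rfl⟩ := QuotientGroup.mk_surjective x
      exact Subtype.ext (commutatorElement_self x)
    · intro x hx z
      obtain ⟨x, rfl⟩ := QuotientGroup.mk_surjective x
      obtain ⟨y, hy⟩ := hG.commutatorHom_surjective hp hcomm
        (fun h => hx ((QuotientGroup.eq_one_iff x).mpr h)) z
      exact ⟨y, hy⟩
    · intro x y
      obtain ⟨x, rfl⟩ := QuotientGroup.mk_surjective x
      obtain ⟨y, rfl⟩ := QuotientGroup.mk_surjective y
      exact Subtype.ext (map_commutatorElement σ x y).symm
  refine ⟨⟨⟨hG, a, ha, hmain.1⟩, hmain.1⟩, ⟨by rw [hmain.2, hmain.1], by rw [hmain.1]⟩, ?_⟩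
  rw [MulAut.quotientCenter_pow, orderOf_pow_of_dvd (by omega)
    (by rw [hσV, Nat.pow_two_mul_sub_one]; exact dvd_mul_right _ _), hσV, Nat.pow_two_mul_sub_one,
    Nat.mul_div_cancel_left _ (by omega)]

end SemiExtraspecialGroups
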